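/- Graphs are finite, undirected and connected, with at least two vertices; loops and multiple edges are allowed, and a loop contributes one to the degree of its vertex. The vertex set carries the graph metric. For a $d$-regular graph $\Gamma$ with adjacency eigenvalues $d=\lambda_1\ge\lambda_2\ge\dots\ge\lambda_n$, the normalized spectral gap is $\delta=(\lambda_1-\lambda_2)/d$. An order is a linear order. For an ordered metric space $(M,T)$ with at least two points and a finite $X\subset M$, let $l_T(X)$ be the length of the path visiting the points of $X$ in $T$-increasing order, $l_{\mathrm{opt}}(X)$ the minimal length of a path visiting all points of $X$, and $\mathrm{OR}_{M,T}(k)=\sup\{l_T(X)/l_{\mathrm{opt}}(X): X\subset M,\ 2\le \#X\le k+1\}$ for $k\ge1$. For a sequence $(M_i,T_i)$ put $\mathrm{OR}(k)=\sup_i \mathrm{OR}_{M_i,T_i}(k)$; its order breakpoint is the smallest integer $s\ge1$ with $\mathrm{OR}(s)<s$, and $\infty$ if there is none. A snake on $k$ points is a sequence $x_1<_T\dots<_T x_k$; its length is the diameter of $\{x_1,\dots,x_k\}$, and its width is the maximum of $d(x_i,x_j)$ over indices $i,j$ of the same parity. **Theorem.** (1) Let $\Gamma_i$ $(i\in\mathbb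 N)$ be $d_i$-regular graphs on $n_i$ vertices, $d_i\ge3$, with normalized spectral gaps $\delta_i$, and let $T_i$ be an order on $\Gamma_i$. Assume that $\log_{d_i}n_i\to\infty$ and $$\frac1{\delta_i}=o\left(\frac{\log_{d_i}n_i}{\ln\log_{d_i}n_i}\right)\qquad(i\to\infty).$$ Then the order breakpoint of the sequence $(\Gamma_i,T_i)$ is infinite. (2) Let $\Gamma$ be a $d$-regular graph on $n$ vertices, $d\ge3$, with normalized spectral gap $\delta$, let $T$ be an order on $\Gamma$, and let $2\le k\le n$. Then $(\Gamma,T)$ admits a snake on $k$ points of width at most $$\left\lceil\frac{24k\,(\ln k+\ln(2/\delta))}{\delta}\right\rceil$$ and of length at least $$\left\lfloor\frac{\ln n-4-2k\ln(2k)-2k\ln(2/\delta)}{\ln(d-1)}\right\rfloor-1 .$$ (3) For every integer $k\ge2$ and every $\delta>0$ there are constants $C,C'>0$, depending only on $k$ and $\delta$, such that the following holds. Let $d\ge3$, let $\Gamma_i$ $(i\in\mathbb N)$ be $d$-regular graphs on $n_i$ vertices with normalized spectral gaps $\delta_i$, $\inf_i\delta_i=\delta$, and let $T_i$ be an order on $\Gamma_i$.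 Then for every $i$ with $n_i\ge k$ the ordered graph $(\Gamma_i,T_i)$ admits a snake on $k$ points of width at most $C$ and of length at least $\log_{d-1}n_i-C'$. -/

import Mathlib

open Filter Asymptotics

open scoped ENNReal

universe u

noncomputable section

/-! ### Ordered metric spaces: order ratio function, order breakpoint, snakes -/

section OrderedMetric

variable {M : Type u} [MetricSpace M]

/-- The length `d(x₁,x₂) + d(x₂,x₃) + ⋯ + d(x_{k-1},x_k)` of a finite path `[x₁, …, x_k]`. -/
def pathLength : List M → ℝ
  | [] => 0
  | [_] => 0
  | x :: y :: l => dist x y + pathLength (y :: l)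

/-- `l_opt(X)`: the minimal length of a path which visits all points of `X`. -/
def optLength (X : Finset M) : ℝ :=
  sInf {r : ℝ | ∃ l : List M, (∀ x ∈ X, x ∈ l) ∧ pathLength l = r}

/-- `l_T(X)`: the length of the path which visits the points of `X` in increasing order for `T`. -/
def orderLength (T : LinearOrder M) (X : Finset M) : ℝ :=
  pathLength (X.sort T.le)

/-- The order ratio function `OR_{M,T}(k)`, the supremum of `l_T(X) / l_opt(X)` over the subsets `X`
of `M` with `2 ≤ #X ≤ k + 1`, and `1` if `M` has at most one point. -/
def orderRatio (T : LinearOrder M) (k : ℕ) : ℝ≥0∞ :=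
  open Classical in
  if Subsingleton M then 1 else
    ⨆ (X : Finset M) (_ : 2 ≤ X.card ∧ X.card ≤ k + 1),
      ENNReal.ofReal (orderLength T X / optLength X)

/-- A snake on `k` points: a sequence `x₁ <_T x₂ <_T ⋯ <_T x_k`. -/
def IsSnake (T : LinearOrder M) {k : ℕ} (x : Fin k → M) : Prop :=
  ∀ i j : Fin k, i < j → T.lt (x i) (x j)

/-- The length of a snake: the diameter of the set of its points. -/
def snakeLength {k : ℕ} (x : Fin k → M) : ℝ :=
  ⨆ p : Fin k × Fin k, dist (x p.1) (x p.2)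

/-- The width of a snake: the maximal distance between two of its points whose indices have the
same parity. -/
def snakeWidth {k : ℕ} (x : Fin k → M) : ℝ :=
  ⨆ p : {p : Fin k × Fin k // (p.1 : ℕ) % 2 = (p.2 : ℕ) % 2}, dist (x p.1.1) (x p.1.2)

/-- `(M, T)` admits a snake on `k` points of width at most `w` and of length at least `L`. -/
def AdmitsSnake (T : LinearOrder M) (k : ℕ) (w L : ℝ) : Prop :=
  ∃ x : Fin k → M, IsSnake T x ∧ snakeWidth x ≤ w ∧ L ≤ snakeLength x

end OrderedMetric

/-- The order ratio function of a sequence of ordered metric spaces `(M_i, T_i)`. -/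
def seqOrderRatio {M : ℕ → Type u} (m : ∀ i, MetricSpace (M i)) (T : ∀ i, LinearOrder (M i))
    (k : ℕ) : ℝ≥0∞ :=
  ⨆ i, @orderRatio (M i) (m i) (T i) k

/-- The order breakpoint of a sequence of ordered metric spaces: the smallest integer `s ≥ 1` with
`OR(s) < s`, and `⊤` if there is no such integer. -/
def seqOrderBreakpoint {M : ℕ → Type u} (m : ∀ i, MetricSpace (M i))
    (T : ∀ i, LinearOrder (M i)) : ℕ∞ :=
  ⨅ (s : ℕ) (_ : 1 ≤ s ∧ seqOrderRatio m T s < s), (s : ℕ∞)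

/-! ### Finite graphs, possibly with loops and multiple edges -/

/-- An undirected graph on `V` in which loops and multiple edges are allowed: `mult v w` is the
number of edges between `v` and `w`, and `mult v v` is the number of loops at `v`. -/
structure Multigraph (V : Type u) where
  mult : V → V → ℕ
  mult_comm : ∀ v w, mult v w = mult w v

namespace Multigraph

variable {V : Type u} (G : Multigraph V)

/-- The simple graph with the same vertices in which distinct vertices are adjacent if they are
joined by at least one edge. -/
def support : SimpleGraph V where
  Adj v w := v ≠ w ∧ G.mult v w ≠ 0
  symm := ⟨fun v w h => ⟨h.1.symm, by rw [G.mult_comm w v]; exact h.2⟩⟩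
  loopless := ⟨fun _ h => h.1 rfl⟩

/-- A graph is connected if any two vertices are joined by a path. -/
def Connected : Prop := G.support.Connected

variable {G} in
/-- The graph metric on the vertices of a connected graph: the distance of two vertices is the
least number of edges of a path between them. -/
abbrev metricSpace (hG : G.Connected) : MetricSpace V where
  dist v w := (G.support.dist v w : ℝ)
  dist_self v := by simp
  dist_comm v w := by rw [SimpleGraph.dist_comm]
  dist_triangle v w z := by exact_mod_cast SimpleGraph.Connected.dist_triangle hG
  eq_of_dist_eq_zero {v w} h := by
    have h' : G.support.dist v w = 0 := by exact_mod_cast h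
    exact (SimpleGraph.Connected.dist_eq_zero_iff hG).1 h'

/-- The adjacency matrix. -/
def adjMatrix : Matrix V V ℝ := Matrix.of fun v w => (G.mult v w : ℝ)

theorem adjMatrix_isHermitian : G.adjMatrix.IsHermitian := by
  ext v w
  simp [adjMatrix, G.mult_comm v w]

variable [Fintype V]

/-- A graph is `d`-regular if every vertex has degree `d`, each loop contributing one to the degree
of its vertex. -/
def IsRegular (d : ℕ) : Prop := ∀ v, ∑ w, G.mult v w = d

/-- The eigenvalues of the adjacency matrix, with multiplicity and in decreasing order:
`G.eigenvalue j` is `λ_{j+1}` for `j < #V` (and `0` for the other `j`, by convention). -/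
def eigenvalue (j : ℕ) : ℝ :=
  open Classical in
  if h : j < Fintype.card V then G.adjMatrix_isHermitian.eigenvalues₀ ⟨j, h⟩ else 0

/-- The normalized spectral gap `(λ₁ - λ₂) / d` of a `d`-regular graph. -/
def spectralGap (d : ℕ) : ℝ := (G.eigenvalue 0 - G.eigenvalue 1) / d

end Multigraph

end

/-! Everything rests on one snake construction. The lazy random walk on a regular graph contracts
functions orthogonal to the constants by `1 - δ/2` per step. Two sets `A`, `B` at distance more than
`r` do not meet under `r` steps of the walk, so `|A| |B| ≤ n² exp(-δ r)`
(`IsRegular.card_mul_card_le`).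

Cut the order into `k` consecutive blocks of `⌊n/k⌋` points. With `r` of order `log k / δ`, few
vertices are at distance more than `r` from some block, so every block keeps more than `n/(4k)` good
vertices, each within `r` of all the blocks. Take a good `p` in the first block and a good `q` in
the second, as far from `p` as possible. Balls grow at most like `(d-1)^R`
(`IsRegular.card_ball_le`), so `q` is at distance about `log_{d-1} n`. Choosing a point near `p` in
each even block and near `q` in each odd block gives a snake of width at most `2r`
(`IsRegular.exists_isSnake`), whatever the order is.

Parts (2) and (3) are estimates of `r` and of the distance from `p` to `q`. For part (1), a snake on
`s + 1` points with width negligible against its length forces the ordered path to cross `s` times,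
while a good path crosses once, so the ratio approaches `s` (`IsSnake.le_orderRatio`). -/

namespace Multigraph

/-! ### Spectrum of a connected regular graph -/

variable {V : Type u} [Fintype V] {G : Multigraph V} {d : ℕ}

/-- The energy identity of a regular graph, for the signed Laplacian `d + s A` with `s ^ 2 = 1`. -/
theorem IsRegular.energy_identity (hd : G.IsRegular d) {s : ℝ} (hs : s ^ 2 = 1) {f : V → ℝ} {a : ℝ}
    (hf : ∀ v, ∑ w, (G.mult v w : ℝ) * f w = a * f v) :
    ∑ v, ∑ w, (G.mult v w : ℝ) * (f v + s * f w) ^ 2 = 2 * (d + s * a) * ∑ v, f v ^ 2 := by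
  have hrow : ∀ v, ∑ w, (G.mult v w : ℝ) = d := fun v => by exact_mod_cast hd v
  have h1 : ∑ v, ∑ w, (G.mult v w : ℝ) * f v ^ 2 = d * ∑ v, f v ^ 2 := by
    simp_rw [← Finset.sum_mul, hrow, Finset.mul_sum]
  have h2 : ∑ v, ∑ w, (G.mult v w : ℝ) * f w ^ 2 = d * ∑ v, f v ^ 2 := by
    rw [Finset.sum_comm, ← h1]
    simp_rw [G.mult_comm]
  have h3 : ∑ v, ∑ w, (G.mult v w : ℝ) * (f v * f w) = a * ∑ v, f v ^ 2 := by
    rw [Finset.mul_sum]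
    refine Finset.sum_congr rfl fun v _ => ?_
    rw [show a * f v ^ 2 = f v * (a * f v) by ring, ← hf v, Finset.mul_sum]
    exact Finset.sum_congr rfl fun w _ => by ring
  calc ∑ v, ∑ w, (G.mult v w : ℝ) * (f v + s * f w) ^ 2
      = ∑ v, ∑ w, ((G.mult v w : ℝ) * f v ^ 2 + (G.mult v w : ℝ) * f w ^ 2
          + 2 * s * ((G.mult v w : ℝ) * (f v * f w))) := by
        refine Finset.sum_congr rfl fun v _ => Finset.sum_congr rfl fun w _ => ?_
        linear_combination ((G.mult v w : ℝ) * f w ^ 2) * hs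
    _ = 2 * (d + s * a) * ∑ v, f v ^ 2 := by
        simp_rw [Finset.sum_add_distrib, ← Finset.mul_sum]
        rw [h1, h2, h3]
        ring

/-- The energy is a nonnegative quantity for both signs `s = ±1`, and its value is a positive
multiple of `d + s a`. -/
theorem IsRegular.abs_eigenvalue_le (hd : G.IsRegular d) {f : V → ℝ} {a : ℝ}
    (hf : ∀ v, ∑ w, (G.mult v w : ℝ) * f w = a * f v) (hpos : 0 < ∑ v, f v ^ 2) :
    -(d : ℝ) ≤ a ∧ a ≤ d := by
  have key : ∀ s : ℝ, s ^ 2 = 1 → 0 ≤ d + s * a := by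
    intro s hs
    have h := hd.energy_identity hs hf
    have h0 : 0 ≤ ∑ v, ∑ w, (G.mult v w : ℝ) * (f v + s * f w) ^ 2 :=
      Finset.sum_nonneg fun v _ => Finset.sum_nonneg fun w _ => by positivity
    rw [h] at h0
    have := nonneg_of_mul_nonneg_left h0 hpos
    linarith
  constructor
  · linarith [key 1 (by norm_num)]
  · linarith [key (-1) (by norm_num)]

/-- For `s = -1` and eigenvalue `d` the energy vanishes, so `f` does not change along any edge;
connectedness does the rest. -/
theorem IsRegular.eq_of_eigenvalue_eq (hd : G.IsRegular d) (hG : G.Connected) {f : V → ℝ}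
    (hf : ∀ v, ∑ w, (G.mult v w : ℝ) * f w = d * f v) (u v : V) : f u = f v := by
  have h := hd.energy_identity (s := -1) (by norm_num) hf
  have h0 : ∑ v, ∑ w, (G.mult v w : ℝ) * (f v + -1 * f w) ^ 2 = 0 := by
    rw [h]; ring
  have hadj : ∀ u v, G.support.Adj u v → f u = f v := by
    intro u v huv
    rw [Finset.sum_eq_zero_iff_of_nonneg
      (fun v _ => Finset.sum_nonneg fun w _ => by positivity)] at h0
    have h1 := h0 u (Finset.mem_univ u)
    rw [Finset.sum_eq_zero_iff_of_nonneg (fun w _ => by positivity)] at h1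
    have h2 := h1 v (Finset.mem_univ v)
    have h3 : (G.mult u v : ℝ) ≠ 0 := by exact_mod_cast huv.2
    have h4 := (pow_eq_zero_iff two_ne_zero).1 ((mul_eq_zero.1 h2).resolve_left h3)
    linarith
  obtain ⟨p⟩ := hG.preconnected u v
  induction p with
  | nil => rfl
  | cons hab _ ih => exact (hadj _ _ hab).trans ih

/-- An orthonormal eigenbasis of a connected regular graph: one vector is constant, and the spectral
gap bounds the eigenvalues of the others. -/
theorem IsRegular.exists_eigenbasis [Nontrivial V] (hd : G.IsRegular d) (hG : G.Connected)
    (hd0 : 0 < d) :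
    0 < G.spectralGap d ∧ G.spectralGap d ≤ 2 ∧
    ∃ (i₀ : V) (b : OrthonormalBasis V ℝ (EuclideanSpace ℝ V)) (a : V → ℝ),
      (∀ j v, ∑ w, (G.mult v w : ℝ) * b j w = a j * b j v) ∧ a i₀ = d ∧
      (∀ u v, b i₀ u = b i₀ v) ∧
      ∀ j, j ≠ i₀ → -(d : ℝ) ≤ a j ∧ a j ≤ d * (1 - G.spectralGap d) := by
  classical
  have hA := G.adjMatrix_isHermitian
  set b := hA.eigenvectorBasis with hb
  have hdR : (0 : ℝ) < d := by exact_mod_cast hd0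
  have hcard : 1 < Fintype.card V := Fintype.one_lt_card
  -- This is the equivalence by which `eigenvalues` is obtained from the sorted `eigenvalues₀`, so
  -- `e` carries sorted positions to basis indices.
  set e : Fin (Fintype.card V) ≃ V := Fintype.equivOfCardEq (Fintype.card_fin _) with he
  have hval : ∀ i, hA.eigenvalues (e i) = hA.eigenvalues₀ i := by
    intro i
    simp [Matrix.IsHermitian.eigenvalues, he]
  have heig : ∀ j v, ∑ w, (G.mult v w : ℝ) * b j w = hA.eigenvalues j * b j v := by
    intro j v
    have := congrFun (hA.mulVec_eigenvectorBasis j) v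
    simpa [Matrix.mulVec, dotProduct, adjMatrix, hb] using this
  have hnorm : ∀ j, ∑ v, b j v ^ 2 = 1 := by
    intro j
    have := b.orthonormal.1 j
    have h2 := EuclideanSpace.real_norm_sq_eq (b j)
    rw [this] at h2
    linarith
  have hbd : ∀ j, -(d : ℝ) ≤ hA.eigenvalues j ∧ hA.eigenvalues j ≤ d := fun j =>
    hd.abs_eigenvalue_le (heig j) (by rw [hnorm j]; norm_num)
  have hconst : ∀ j, hA.eigenvalues j = d → ∀ u v, b j u = b j v := by
    intro j hj
    exact hd.eq_of_eigenvalue_eq hG (by simpa [hj] using heig j)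
  -- Summing the eigenvalue equation over all vertices multiplies the total by `d`, since the column
  -- sums are `d` too.
  have hsum : ∀ j, hA.eigenvalues j ≠ d → ∑ v, b j v = 0 := by
    intro j hj
    have h1 : ∑ v, ∑ w, (G.mult v w : ℝ) * b j w = d * ∑ w, b j w := by
      rw [Finset.sum_comm, Finset.mul_sum]
      refine Finset.sum_congr rfl fun w _ => ?_
      rw [← Finset.sum_mul]
      congr 1
      simp_rw [G.mult_comm _ w]
      exact_mod_cast hd w
    simp_rw [heig j, ← Finset.mul_sum] at h1
    have : (hA.eigenvalues j - d) * ∑ v, b j v = 0 := by linarith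
    exact (mul_eq_zero.1 this).resolve_left (sub_ne_zero.2 hj)
  let i0 : Fin (Fintype.card V) := ⟨0, by omega⟩
  let i1 : Fin (Fintype.card V) := ⟨1, hcard⟩
  -- Otherwise the all-ones vector would be orthogonal to the whole basis.
  have hex : ∃ j, hA.eigenvalues j = d := by
    by_contra! hne
    have h1 := b.sum_sq_norm_inner_right (WithLp.toLp 2 (fun _ : V => (1 : ℝ)))
    have h2 : ∀ j, inner ℝ (b j) (WithLp.toLp 2 (fun _ : V => (1 : ℝ))) = 0 := by
      intro j
      simpa [PiLp.inner_apply] using hsum j (hne j)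
    simp only [h2] at h1
    rw [EuclideanSpace.real_norm_sq_eq] at h1
    have hc : (Fintype.card V : ℝ) ≠ 0 := by exact_mod_cast Fintype.card_ne_zero
    simp at h1
    exact hc h1.symm
  have h0 : hA.eigenvalues (e i0) = d := by
    obtain ⟨j, hj⟩ := hex
    refine le_antisymm (hbd _).2 ?_
    rw [← hj, ← e.apply_symm_apply j, hval, hval]
    exact hA.eigenvalues₀_antitone (Fin.mk_le_mk.2 (Nat.zero_le _))
  -- The eigenvalue `d` is simple: two constant unit vectors cannot be orthogonal.
  have h1 : hA.eigenvalues (e i1) < d := by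
    refine lt_of_le_of_ne (hbd _).2 fun h => ?_
    have ho : inner ℝ (b (e i0)) (b (e i1)) = (0 : ℝ) :=
      b.orthonormal.2 (e.injective.ne (by simp [i0, i1]))
    obtain ⟨v₀⟩ : Nonempty V := inferInstance
    have hc0 := fun v => hconst _ h0 v v₀
    have hc1 := fun v => hconst _ h v v₀
    have hn0 := hnorm (e i0)
    have hn1 := hnorm (e i1)
    simp_rw [hc0] at hn0
    simp_rw [hc1] at hn1
    simp [PiLp.inner_apply, hc0, hc1] at ho hn0 hn1
    rcases ho with ho | ho <;> simp [ho] at hn0 hn1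
  have hgap : G.spectralGap d = (d - hA.eigenvalues (e i1)) / d := by
    rw [spectralGap, eigenvalue, eigenvalue, dif_pos hcard, dif_pos (by omega), ← h0, hval, hval]
  have hgap' : (d : ℝ) * (1 - G.spectralGap d) = hA.eigenvalues (e i1) := by
    rw [hgap]; field_simp; ring
  refine ⟨?_, ?_, e i0, b, hA.eigenvalues, heig, h0, hconst _ h0, fun j hj => ⟨(hbd j).1, ?_⟩⟩
  · rw [hgap]; exact div_pos (by linarith) hdR
  · rw [hgap, div_le_iff₀ hdR]; linarith [(hbd (e i1)).1]
  · rw [hgap', ← e.apply_symm_apply j, hval, hval]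
    refine hA.eigenvalues₀_antitone (Fin.mk_le_of_le_val ?_)
    rw [Nat.one_le_iff_ne_zero]
    intro h
    apply hj
    rw [← e.apply_symm_apply j]
    congr 1
    exact Fin.ext h

theorem IsRegular.spectralGap_pos [Nontrivial V] (hd : G.IsRegular d) (hG : G.Connected)
    (hd0 : 0 < d) : 0 < G.spectralGap d := (hd.exists_eigenbasis hG hd0).1

theorem IsRegular.spectralGap_le_two [Nontrivial V] (hd : G.IsRegular d) (hG : G.Connected)
    (hd0 : 0 < d) : G.spectralGap d ≤ 2 := (hd.exists_eigenbasis hG hd0).2.1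

/-! ### Mixing of the lazy random walk -/

/-- One step of the lazy random walk on a `d`-regular graph. -/
noncomputable def lazyStep (G : Multigraph V) (d : ℕ) (f : V → ℝ) (v : V) : ℝ :=
  (f v + (∑ w, (G.mult v w : ℝ) * f w) / d) / 2

/-- A step of the walk reads only a vertex and its neighbours, so supports spread by at most one per
step. -/
theorem exists_dist_le_of_lazyStep_iterate_ne_zero (hG : G.Connected) (f : V → ℝ) (r : ℕ) (v : V)
    (h : (G.lazyStep d)^[r] f v ≠ 0) : ∃ w, f w ≠ 0 ∧ G.support.dist v w ≤ r := by
  induction r generalizing v with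
  | zero => exact ⟨v, h, by simp⟩
  | succ r ih =>
    rw [Function.iterate_succ_apply'] at h
    set g := (G.lazyStep d)^[r] f
    by_cases hv : g v = 0
    · have hs : ∑ w, (G.mult v w : ℝ) * g w ≠ 0 := by
        intro hs
        apply h
        simp [lazyStep, hv, hs]
      obtain ⟨w, -, hw⟩ := Finset.exists_ne_zero_of_sum_ne_zero hs
      obtain ⟨x, hx, hxd⟩ := ih w (right_ne_zero_of_mul hw)
      refine ⟨x, hx, ?_⟩
      have hne : v ≠ w := by
        rintro rfl
        exact right_ne_zero_of_mul hw hv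
      have hadj : G.support.Adj v w := ⟨hne, by exact_mod_cast left_ne_zero_of_mul hw⟩
      have h1 : G.support.dist v w = 1 := SimpleGraph.dist_eq_one_iff_adj.2 hadj
      have := SimpleGraph.Connected.dist_triangle hG (u := v) (v := w) (w := x)
      omega
    · obtain ⟨x, hx, hxd⟩ := ih v hv
      exact ⟨x, hx, by omega⟩

/-- By symmetry of the adjacency matrix the step can be moved onto the eigenvector `f`, where it
acts as the scalar `(1 + a/d)/2`. -/
theorem sum_mul_lazyStep (f g : V → ℝ) {a : ℝ}
    (hf : ∀ v, ∑ w, (G.mult v w : ℝ) * f w = a * f v) :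
    ∑ v, f v * G.lazyStep d g v = (1 + a / d) / 2 * ∑ v, f v * g v := by
  have h1 : ∑ v, f v * ∑ w, (G.mult v w : ℝ) * g w = a * ∑ v, f v * g v := by
    simp_rw [Finset.mul_sum]
    rw [Finset.sum_comm]
    refine Finset.sum_congr rfl fun w _ => ?_
    rw [← mul_assoc, ← hf w, Finset.sum_mul]
    refine Finset.sum_congr rfl fun v _ => ?_
    rw [G.mult_comm]
    ring
  calc ∑ v, f v * G.lazyStep d g v
      = ∑ v, (f v * g v / 2 + (f v * ∑ w, (G.mult v w : ℝ) * g w) / (2 * d)) := by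
        refine Finset.sum_congr rfl fun v _ => ?_
        rw [lazyStep]
        field_simp
    _ = _ := by
        rw [Finset.sum_add_distrib, ← Finset.sum_div, ← Finset.sum_div, h1]
        field_simp

theorem sum_mul_lazyStep_iterate (f g : V → ℝ) {a : ℝ}
    (hf : ∀ v, ∑ w, (G.mult v w : ℝ) * f w = a * f v) (r : ℕ) :
    ∑ v, f v * (G.lazyStep d)^[r] g v = ((1 + a / d) / 2) ^ r * ∑ v, f v * g v := by
  induction r with
  | zero => simp
  | succ r ih =>
    rw [Function.iterate_succ_apply', sum_mul_lazyStep _ _ hf, ih]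
    ring

/-- Two sets of vertices at distance more than `r` are small, by the mixing of the lazy walk. -/
theorem IsRegular.card_mul_card_le [Nontrivial V] (hd : G.IsRegular d) (hG : G.Connected)
    (hd0 : 0 < d) (A B : Finset V) (r : ℕ) (hAB : ∀ a ∈ A, ∀ b ∈ B, r < G.support.dist a b) :
    (A.card : ℝ) * B.card ≤ (Fintype.card V : ℝ) ^ 2 * Real.exp (-(G.spectralGap d * r)) := by
  classical
  obtain ⟨hpos, hle, i₀, b, a, heig, ha0, hconst, hbd⟩ := hd.exists_eigenbasis hG hd0
  set δ := G.spectralGap d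
  have hdR : (0 : ℝ) < d := by exact_mod_cast hd0
  let f : V → ℝ := fun v => if v ∈ A then 1 else 0
  let g : V → ℝ := fun v => if v ∈ B then 1 else 0
  have hzero : ∑ v, f v * (G.lazyStep d)^[r] g v = 0 := by
    refine Finset.sum_eq_zero fun v _ => ?_
    by_contra hne
    obtain ⟨w, hw, hwd⟩ :=
      exists_dist_le_of_lazyStep_iterate_ne_zero hG g r v (right_ne_zero_of_mul hne)
    have hvA : v ∈ A := by
      by_contra h
      exact left_ne_zero_of_mul hne (by simp [f, h])
    have hwB : w ∈ B := by
      by_contra h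
      exact hw (by simp [g, h])
    exact absurd (hAB v hvA w hwB) (by omega)
  have hinner : ∀ x y : V → ℝ, inner ℝ (WithLp.toLp 2 x) (WithLp.toLp 2 y) = ∑ v, x v * y v := by
    intro x y
    simp [PiLp.inner_apply, mul_comm]
  let p : V → ℝ := fun j => ∑ v, b j v * f v
  let q : V → ℝ := fun j => ∑ v, b j v * g v
  -- Parseval in the eigenbasis.
  have hpars : ∀ x y : V → ℝ, ∑ j, (∑ v, b j v * x v) * (∑ v, b j v * y v) = ∑ v, x v * y v := by
    intro x y
    rw [← hinner x y, ← b.sum_inner_mul_inner]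
    refine Finset.sum_congr rfl fun j _ => ?_
    rw [real_inner_comm]
    exact congrArg₂ _ (hinner (b j) x).symm (hinner (b j) y).symm
  have hsum : ∑ j, p j * (((1 + a j / d) / 2) ^ r * q j) = 0 := by
    rw [← hzero, ← hpars f]
    refine Finset.sum_congr rfl fun j _ => ?_
    rw [sum_mul_lazyStep_iterate _ _ (heig j)]
  have hp2 : ∑ j, p j ^ 2 = A.card := by
    have := hpars f f
    simp only [← pow_two] at this
    rw [this]
    simp [f]
  have hq2 : ∑ j, q j ^ 2 = B.card := by
    have := hpars g g
    simp only [← pow_two] at this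
    rw [this]
    simp [g]
  -- The constant unit vector has entries of square `1/n`.
  have hmain : p i₀ * q i₀ = (A.card : ℝ) * B.card / Fintype.card V := by
    have hn : ∑ v, b i₀ v ^ 2 = 1 := by
      have := b.orthonormal.1 i₀
      have h2 := EuclideanSpace.real_norm_sq_eq (b i₀)
      rw [this] at h2
      linarith
    simp_rw [fun v => hconst v i₀] at hn
    simp only [Finset.sum_const, Finset.card_univ, nsmul_eq_mul] at hn
    have hn0 : (Fintype.card V : ℝ) ≠ 0 := left_ne_zero_of_mul (hn.trans_ne one_ne_zero)
    have hp : p i₀ = b i₀ i₀ * A.card := by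
      simp only [p, fun v => hconst v i₀, ← Finset.mul_sum]
      simp [f]
    have hq : q i₀ = b i₀ i₀ * B.card := by
      simp only [q, fun v => hconst v i₀, ← Finset.mul_sum]
      simp [g]
    rw [hp, hq, eq_div_iff hn0]
    linear_combination (A.card * B.card : ℝ) * hn
  -- Laziness maps `a/d ∈ [-1, 1 - δ]` into `[0, c]`, so eigenvalues near `-d` do no harm.
  set c := 1 - δ / 2
  have hc0 : 0 ≤ c := by simp only [c]; linarith
  have hbound : p i₀ * q i₀ ≤ c ^ r * Real.sqrt (A.card * B.card) := by
    rw [← Finset.add_sum_erase _ _ (Finset.mem_univ i₀), ha0, div_self hdR.ne'] at hsum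
    rw [add_self_div_two, one_pow, one_mul] at hsum
    have h1 : p i₀ * q i₀ = ∑ j ∈ Finset.univ.erase i₀, -(p j * (((1 + a j / d) / 2) ^ r * q j)) := by
      rw [Finset.sum_neg_distrib]; linarith
    have h2 : p i₀ * q i₀ ≤ ∑ j ∈ Finset.univ.erase i₀, c ^ r * (|p j| * |q j|) := by
      rw [h1]
      refine Finset.sum_le_sum fun j hj => ?_
      obtain ⟨hl, hu⟩ := hbd j (Finset.ne_of_mem_erase hj)
      have hl' : -1 ≤ a j / d := by rw [le_div_iff₀ hdR]; linarith
      have hu' : a j / d ≤ 1 - δ := by rw [div_le_iff₀ hdR]; linarith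
      have hm : ((1 + a j / d) / 2) ^ r ≤ c ^ r :=
        pow_le_pow_left₀ (by linarith) (by simp only [c]; linarith) r
      have hm0 : 0 ≤ ((1 + a j / d) / 2) ^ r := pow_nonneg (by linarith) r
      calc -(p j * (((1 + a j / d) / 2) ^ r * q j)) ≤ |p j * (((1 + a j / d) / 2) ^ r * q j)| :=
            neg_le_abs _
        _ = ((1 + a j / d) / 2) ^ r * (|p j| * |q j|) := by
            rw [abs_mul, abs_mul, abs_of_nonneg hm0]; ring
        _ ≤ _ := by gcongr
    refine h2.trans ?_
    rw [← Finset.mul_sum]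
    refine mul_le_mul_of_nonneg_left ?_ (pow_nonneg hc0 r)
    calc ∑ j ∈ Finset.univ.erase i₀, |p j| * |q j| ≤ ∑ j, |p j| * |q j| :=
          Finset.sum_le_sum_of_subset_of_nonneg (Finset.erase_subset _ _)
            fun _ _ _ => by positivity
      _ ≤ √(∑ j, |p j| ^ 2) * √(∑ j, |q j| ^ 2) := Real.sum_mul_le_sqrt_mul_sqrt _ _ _
      _ = √(A.card * B.card) := by
          simp_rw [sq_abs]
          rw [hp2, hq2, Real.sqrt_mul (by positivity)]
  have hexp : c ^ r ≤ Real.exp (-(δ * r / 2)) := by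
    calc c ^ r ≤ Real.exp (-(δ / 2)) ^ r :=
          pow_le_pow_left₀ hc0 (by simp only [c]; linarith [Real.add_one_le_exp (-(δ / 2))]) r
      _ = _ := by rw [← Real.exp_nat_mul]; congr 1; ring
  set s := Real.sqrt ((A.card : ℝ) * B.card) with hs
  have hss : s ^ 2 = (A.card : ℝ) * B.card := Real.sq_sqrt (by positivity)
  have hn : (0 : ℝ) < Fintype.card V := by exact_mod_cast Fintype.card_pos
  have hs0 : 0 ≤ s := Real.sqrt_nonneg _
  -- The bound reads `s² ≤ c^r s n`; one factor `s` cancels unless it is zero. Squaring afterwards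
  -- doubles the rate `δ/2`.
  have hfin : s ≤ Fintype.card V * Real.exp (-(δ * r / 2)) := by
    rw [hmain, ← hss, div_le_iff₀ hn] at hbound
    rcases hs0.eq_or_lt with h | h
    · rw [← h]; positivity
    · refine le_of_mul_le_mul_left ?_ h
      calc s * s ≤ c ^ r * s * Fintype.card V := by rw [← pow_two]; exact hbound
        _ ≤ Real.exp (-(δ * r / 2)) * s * Fintype.card V := by gcongr
        _ = _ := by ring
  calc (A.card : ℝ) * B.card = s ^ 2 := hss.symm
    _ ≤ (Fintype.card V * Real.exp (-(δ * r / 2))) ^ 2 := pow_le_pow_left₀ hs0 hfin 2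
    _ = _ := by
      rw [mul_pow, ← Real.exp_nat_mul]
      congr 2
      push_cast
      ring

/-! ### Growth of balls -/

/-- In a graph of degree at least three, balls grow at most like the powers of `d - 1`. -/
theorem IsRegular.card_ball_le (hd : G.IsRegular d) (hG : G.Connected) (hd3 : 3 ≤ d) (v : V)
    (R : ℕ) (S : Finset V) (hS : ∀ w ∈ S, G.support.dist v w ≤ R) : S.card ≤ 4 * (d - 1) ^ R := by
  classical
  have hdeg : ∀ u, (Finset.univ.filter fun w => G.support.Adj u w).card ≤ d := by
    intro u
    rw [← hd u, Finset.card_eq_sum_ones]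
    refine (Finset.sum_le_sum fun w hw => ?_).trans
      (Finset.sum_le_sum_of_subset (Finset.subset_univ _))
    exact Nat.one_le_iff_ne_zero.2 (Finset.mem_filter.1 hw).2.2
  have hprev : ∀ w R, G.support.dist v w = R + 1 → ∃ u, G.support.dist v u = R ∧
      G.support.Adj u w := by
    intro w R hw
    obtain ⟨p, hp⟩ := SimpleGraph.Connected.exists_walk_length_eq_dist hG w v
    rw [SimpleGraph.dist_comm, hw] at hp
    cases p with
    | nil => simp at hp
    | cons h p =>
      rename_i u
      refine ⟨u, ?_, h.symm⟩
      simp only [SimpleGraph.Walk.length_cons, Nat.add_right_cancel_iff] at hp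
      have h1 := SimpleGraph.dist_le p
      have h2 := SimpleGraph.Connected.dist_triangle hG (u := w) (v := u) (w := v)
      rw [SimpleGraph.dist_eq_one_iff_adj.2 h, G.support.dist_comm (u := w), hw] at h2
      rw [SimpleGraph.dist_comm]
      omega
  let sph : ℕ → Finset V := fun R => Finset.univ.filter fun w => G.support.dist v w = R
  have hstep : ∀ R, (sph (R + 1)).card ≤
      ∑ u ∈ sph R, (Finset.univ.filter fun w => G.support.Adj u w ∧ w ∈ sph (R + 1)).card := by
    intro R
    refine (Finset.card_le_card ?_).trans Finset.card_biUnion_le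
    intro w hw
    obtain ⟨u, hu, huw⟩ := hprev w R (Finset.mem_filter.1 hw).2
    exact Finset.mem_biUnion.2 ⟨u, by simp [sph, hu], by simp [huw, hw]⟩
  have hsph0 : (sph 0).card ≤ 1 := by
    refine Finset.card_le_one.2 fun x hx y hy => ?_
    simp only [sph, Finset.mem_filter, SimpleGraph.Connected.dist_eq_zero_iff hG] at hx hy
    exact hx.2.symm.trans hy.2
  -- Away from the centre one neighbour leads back, leaving at most `d - 1` outward ones. The factor
  -- `2` covers the first sphere, as `d ≤ 2 (d - 1)`.
  have hsph : ∀ R, (sph (R + 1)).card ≤ 2 * (d - 1) ^ (R + 1) := by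
    intro R
    induction R with
    | zero =>
      refine (hstep 0).trans ((Finset.sum_le_card_nsmul _ _ d fun u _ =>
        (Finset.card_le_card ?_).trans (hdeg u)).trans ?_)
      · intro w; simp +contextual
      · have : (sph 0).card * d ≤ 1 * d := Nat.mul_le_mul_right d hsph0
        simp only [smul_eq_mul, zero_add, pow_one]
        omega
    | succ R ih =>
      refine (hstep (R + 1)).trans ((Finset.sum_le_card_nsmul _ _ (d - 1) fun u hu => ?_).trans ?_)
      · obtain ⟨t, ht, htu⟩ := hprev u R (Finset.mem_filter.1 hu).2
        have hmem : t ∈ Finset.univ.filter fun w => G.support.Adj u w := by simp [htu.symm]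
        refine (Finset.card_le_card (t := (Finset.univ.filter fun w =>
          G.support.Adj u w).erase t) ?_).trans ?_
        · intro w hw
          simp only [sph, Finset.mem_filter, Finset.mem_univ, true_and, Finset.mem_erase] at hw ⊢
          refine ⟨?_, hw.1⟩
          rintro rfl
          omega
        · rw [Finset.card_erase_of_mem hmem]
          exact Nat.sub_le_sub_right (hdeg u) 1
      · rw [smul_eq_mul, pow_succ, ← mul_assoc]
        exact Nat.mul_le_mul_right _ ih
  have hball : ∀ R, (Finset.univ.filter fun w => G.support.dist v w ≤ R).card ≤
      4 * (d - 1) ^ R := by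
    intro R
    induction R with
    | zero =>
      refine (Finset.card_le_card (t := sph 0) ?_).trans (hsph0.trans (by simp))
      intro w
      simp [sph]
    | succ R ih =>
      refine (Finset.card_le_card (t := (Finset.univ.filter fun w => G.support.dist v w ≤ R) ∪
        sph (R + 1)) ?_).trans ((Finset.card_union_le _ _).trans ?_)
      · intro w
        simp only [sph, Finset.mem_filter, Finset.mem_univ, true_and, Finset.mem_union]
        omega
      · have h1 := hsph R
        have h2 : 4 * (d - 1) ^ R ≤ 2 * (d - 1) ^ (R + 1) := by
          rw [pow_succ]
          have : 2 ≤ d - 1 := by omega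
          nlinarith [Nat.zero_le ((d - 1) ^ R)]
        omega
  exact (Finset.card_le_card fun w hw => by simpa using hS w hw).trans (hball R)

end Multigraph

/-! ### Snakes from blocks of the order -/

/-- Consecutive blocks of equal size in a finite linear order. -/
theorem exists_ordered_blocks {V : Type u} [Fintype V] (T : LinearOrder V) {k m : ℕ}
    (hkm : k * m ≤ Fintype.card V) :
    ∃ B : Fin k → Finset V, (∀ i, (B i).card = m) ∧
      ∀ i j, i < j → ∀ a ∈ B i, ∀ b ∈ B j, T.lt a b := by
  let e : Fin (Fintype.card V) ≃o V := monoEquivOfFin V rfl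
  have hlt : ∀ (i : Fin k) (t : Fin m), (i : ℕ) * m + t < Fintype.card V := by
    intro i t
    have h1 : ((i : ℕ) + 1) * m ≤ k * m := Nat.mul_le_mul_right m i.2
    have h2 := t.2
    rw [Nat.add_mul, one_mul] at h1
    omega
  let φ : (i : Fin k) → Fin m ↪ V := fun i =>
    ⟨fun t => e ⟨i * m + t, hlt i t⟩, fun s t hst => by
      have := e.injective hst
      rw [Fin.mk.injEq] at this
      exact Fin.ext (by omega)⟩
  refine ⟨fun i => Finset.univ.map (φ i), fun i => by simp, ?_⟩
  intro i j hij a ha b hb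
  obtain ⟨s, -, rfl⟩ := Finset.mem_map.1 ha
  obtain ⟨t, -, rfl⟩ := Finset.mem_map.1 hb
  refine e.strictMono (Fin.mk_lt_mk.2 ?_)
  have h1 : ((i : ℕ) + 1) * m ≤ j * m := Nat.mul_le_mul_right m hij
  have h2 := s.2
  rw [Nat.add_mul, one_mul] at h1
  omega

namespace Multigraph

variable {V : Type u} [Fintype V] [Nontrivial V] {G : Multigraph V} {d : ℕ}

/-- Snakes in a connected regular graph: the points of even index and those of odd index lie in
two balls of radius `r`, whose centres are as far apart as the growth of balls permits. -/
theorem IsRegular.exists_isSnake (hd : G.IsRegular d) (hG : G.Connected) (hd3 : 3 ≤ d)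
    (T : LinearOrder V) {k r : ℕ} (hk : 2 ≤ k) (hkn : k ≤ Fintype.card V)
    (hr : 8 * (k : ℝ) ^ 3 ≤ Real.exp (G.spectralGap d * r)) :
    ∃ x : Fin k → V, IsSnake T x ∧
      (∀ i j : Fin k, (i : ℕ) % 2 = (j : ℕ) % 2 → G.support.dist (x i) (x j) ≤ 2 * r) ∧
      ∀ R : ℕ, 16 * k * (d - 1) ^ R < Fintype.card V →
        R < G.support.dist (x ⟨0, by omega⟩) (x ⟨1, by omega⟩) := by
  classical
  set n := Fintype.card V with hn
  have hk0 : 0 < k := by omega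
  set m := n / k with hm
  have hnm : n < 2 * k * m := by
    have h1 : 1 ≤ m := (Nat.one_le_div_iff hk0).2 hkn
    have h2 := Nat.lt_mul_div_succ n hk0
    rw [← hm] at h2
    nlinarith [Nat.mul_le_mul_left k h1]
  obtain ⟨B, hBcard, hBlt⟩ := exists_ordered_blocks T (k := k) (m := m)
    (by rw [mul_comm]; exact Nat.div_mul_le_self n k)
  let bad : Fin k → Finset V := fun j =>
    Finset.univ.filter fun v => ∀ b ∈ B j, r < G.support.dist v b
  have hkR : (0 : ℝ) < k := by exact_mod_cast hk0
  have hnR : (0 : ℝ) < n := by exact_mod_cast (by omega : 0 < n)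
  have hnmR : (n : ℝ) < 2 * k * m := by exact_mod_cast hnm
  -- Mixing and `hr` give `|bad j| · m · 8k³ ≤ n²`, and `m > n/(2k)`.
  have hbad : ∀ j, ((bad j).card : ℝ) * (4 * k ^ 2) ≤ n := by
    intro j
    have h := hd.card_mul_card_le hG (by omega) (bad j) (B j) r
      fun a ha b hb => (Finset.mem_filter.1 ha).2 b hb
    rw [hBcard, ← hn, Real.exp_neg, ← div_eq_mul_inv, le_div_iff₀ (Real.exp_pos _)] at h
    have hmR : (0 : ℝ) < m := by
      by_contra hneg
      nlinarith [mul_nonneg hkR.le (neg_nonneg.2 (not_lt.1 hneg))]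
    have h1 : ((bad j).card : ℝ) * m * (8 * k ^ 3) ≤ n ^ 2 :=
      (mul_le_mul_of_nonneg_left hr (by positivity)).trans h
    have h2 : ((bad j).card : ℝ) * (4 * k ^ 2) * n ≤ n * n := by
      calc ((bad j).card : ℝ) * (4 * k ^ 2) * (n : ℝ)
          ≤ (bad j).card * (4 * k ^ 2) * (2 * k * (m : ℝ)) := by gcongr
        _ = (bad j).card * (m : ℝ) * (8 * (k : ℝ) ^ 3) := by ring
        _ ≤ (n : ℝ) * n := by rw [← pow_two]; exact h1
    exact le_of_mul_le_mul_right h2 hnR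
  let allBad : Finset V := Finset.univ.biUnion bad
  have hall : 4 * k * allBad.card ≤ n := by
    have h1 : (allBad.card : ℝ) ≤ ∑ j, ((bad j).card : ℝ) := by
      exact_mod_cast Finset.card_biUnion_le
    have h2 : (4 * k * allBad.card : ℝ) * k ≤ n * k := by
      calc (4 * k * allBad.card : ℝ) * k ≤ (∑ j, ((bad j).card : ℝ)) * (4 * k ^ 2) := by
            nlinarith [mul_le_mul_of_nonneg_left h1 (by positivity : (0 : ℝ) ≤ 4 * k ^ 2)]
        _ = ∑ j, ((bad j).card : ℝ) * (4 * k ^ 2) := Finset.sum_mul _ _ _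
        _ ≤ ∑ _j : Fin k, (n : ℝ) := Finset.sum_le_sum fun j _ => hbad j
        _ = n * k := by simp [mul_comm]
    exact_mod_cast le_of_mul_le_mul_right h2 hkR
  have hgood : ∀ j, n < 4 * k * (B j \ allBad).card := by
    intro j
    have h1 := Finset.le_card_sdiff allBad (B j)
    rw [hBcard] at h1
    have h2 : m ≤ (B j \ allBad).card + allBad.card := by omega
    nlinarith [Nat.mul_le_mul_left (4 * k) h2]
  have hnear : ∀ v, v ∉ allBad → ∀ j, ∃ b ∈ B j, G.support.dist v b ≤ r := by
    intro v hv j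
    by_contra! h
    exact hv (Finset.mem_biUnion.2 ⟨j, Finset.mem_univ _, by simpa [bad] using h⟩)
  have hne : ∀ j, (B j \ allBad).Nonempty := fun j => by
    rw [← Finset.card_pos]
    by_contra hc
    have := hgood j
    simp [Nat.eq_zero_of_not_pos hc] at this
  let j0 : Fin k := ⟨0, by omega⟩
  let j1 : Fin k := ⟨1, by omega⟩
  obtain ⟨p, hp⟩ := hne j0
  obtain ⟨q, hq, hqmax⟩ := (B j1 \ allBad).exists_max_image (fun v => G.support.dist p v) (hne j1)
  rw [Finset.mem_sdiff] at hp hq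
  let c : Fin k → V := fun j => if (j : ℕ) % 2 = 0 then p else q
  -- The first two points must be `p` and `q` themselves, so that their distance is the one
  -- maximised above.
  have hc : ∀ j, ∃ b ∈ B j, G.support.dist (c j) b ≤ r ∧ (j = j0 → b = p) ∧ (j = j1 → b = q) := by
    intro j
    by_cases h0 : j = j0
    · subst h0
      exact ⟨p, hp.1, by simp [c, j0], fun _ => rfl, fun h => by simp [j0, j1] at h⟩
    by_cases h1 : j = j1
    · subst h1
      exact ⟨q, hq.1, by simp [c, j1], fun h => absurd h h0, fun _ => rfl⟩
    obtain ⟨b, hb, hbd⟩ := hnear (c j) (by simp only [c]; split_ifs; exacts [hp.2, hq.2]) j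
    exact ⟨b, hb, hbd, fun h => absurd h h0, fun h => absurd h h1⟩
  choose x hxB hxd hx0 hx1 using hc
  refine ⟨x, fun i j hij => hBlt i j hij _ (hxB i) _ (hxB j), ?_, ?_⟩
  · intro i j hij
    have hcc : c i = c j := by simp only [c, hij]
    have h1 := hxd i
    have h2 := hxd j
    have h3 := SimpleGraph.Connected.dist_triangle hG (u := x i) (v := c i) (w := x j)
    rw [← hcc] at h2
    rw [G.support.dist_comm (u := x i) (v := c i)] at h3
    omega
  · intro R hR
    change R < G.support.dist (x j0) (x j1)
    rw [hx0 j0 rfl, hx1 j1 rfl]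
    by_contra hle
    -- If `q` were within `R`, the ball about `p` would contain all good points of the second block,
    -- more than `n/(4k)` of them.
    have h1 := hd.card_ball_le hG hd3 p R (B j1 \ allBad)
      fun w hw => (hqmax w hw).trans (not_lt.1 hle)
    have h2 := Nat.mul_le_mul_left (4 * k) h1
    have h3 := hgood j1
    have h4 : 4 * k * (4 * (d - 1) ^ R) = 16 * k * (d - 1) ^ R := by ring
    omega

/-- An admissible radius in `IsRegular.exists_isSnake`. -/
theorem exp_ceil_radius {k : ℕ} (hk : 0 < k) {δ : ℝ} (hδ : 0 < δ) :
    8 * (k : ℝ) ^ 3 ≤ Real.exp (δ * (⌈3 * Real.log (2 * k) / δ⌉₊ : ℕ)) := by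
  have hk' : (0 : ℝ) < 2 * k := by positivity
  calc 8 * (k : ℝ) ^ 3 = Real.exp (3 * Real.log (2 * k)) := by
        rw [show (3 : ℝ) * Real.log (2 * k) = ((3 : ℕ) : ℝ) * Real.log (2 * k) by norm_num,
          Real.exp_nat_mul, Real.exp_log hk']
        ring
    _ ≤ _ := by
        refine Real.exp_le_exp.2 ?_
        have := Nat.le_ceil (3 * Real.log (2 * k) / δ)
        rwa [div_le_iff₀' hδ] at this

end Multigraph

/-! ### Path lengths and the order ratio of a snake -/

theorem IsSnake.sort_image {M : Type u} [DecidableEq M] {T : LinearOrder M} {k : ℕ} {x : Fin k → M}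
    (hx : IsSnake T x) : (Finset.univ.image x).sort T.le = List.ofFn x := by
  have hmono : @StrictMono _ _ _ T.toPreorder x := fun i j hij => hx i j hij
  have hcard : (Finset.univ.image x).card = k := by
    rw [Finset.card_image_of_injective _ hmono.injective, Finset.card_univ, Fintype.card_fin]
  rw [← Finset.listMap_orderEmbOfFin_finRange _ hcard,
    ← Finset.orderEmbOfFin_unique hcard (fun i => Finset.mem_image_of_mem x (Finset.mem_univ i))
      hmono, List.ofFn_eq_map]

section OrderedMetric

variable {M : Type u} [MetricSpace M]

theorem pathLength_nonneg (l : List M) : 0 ≤ pathLength l := by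
  induction l with
  | nil => exact le_rfl
  | cons a l ih =>
    cases l with
    | nil => exact le_rfl
    | cons b l => exact add_nonneg dist_nonneg ih

theorem dist_head_le_pathLength (a : M) (l : List M) {y : M} (hy : y ∈ a :: l) :
    dist a y ≤ pathLength (a :: l) := by
  induction l generalizing a with
  | nil => simp_all [pathLength]
  | cons b l ih =>
    rcases List.mem_cons.1 hy with rfl | hy
    · rw [dist_self]; exact pathLength_nonneg _
    · calc dist a y ≤ dist a b + dist b y := dist_triangle _ _ _
        _ ≤ dist a b + pathLength (b :: l) := by gcongr; exact ih b hy

theorem pathLength_le_cons (a : M) (l : List M) : pathLength l ≤ pathLength (a :: l) := by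
  cases l with
  | nil => exact le_rfl
  | cons b l => exact le_add_of_nonneg_left dist_nonneg

theorem dist_le_pathLength (l : List M) {x y : M} (hx : x ∈ l) (hy : y ∈ l) :
    dist x y ≤ pathLength l := by
  induction l with
  | nil => simp at hx
  | cons a l ih =>
    rcases List.mem_cons.1 hx with rfl | hx'
    · exact dist_head_le_pathLength _ _ hy
    rcases List.mem_cons.1 hy with rfl | hy'
    · rw [dist_comm]; exact dist_head_le_pathLength _ _ hx
    exact (ih hx' hy').trans (pathLength_le_cons a l)

theorem pathLength_le_of_dist_le {w : ℝ} (hw : 0 ≤ w) (l : List M)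
    (h : ∀ a ∈ l, ∀ b ∈ l, dist a b ≤ w) : pathLength l ≤ l.length * w := by
  induction l with
  | nil => simp [pathLength]
  | cons a l ih =>
    have ih' := ih fun x hx y hy => h x (List.mem_cons_of_mem _ hx) y (List.mem_cons_of_mem _ hy)
    cases l with
    | nil => simpa [pathLength] using hw
    | cons b l =>
      have := h a (by simp) b (by simp)
      rw [pathLength, List.length_cons]
      push_cast at ih' ⊢
      linarith

theorem pathLength_append_le {D : ℝ} (hD : 0 ≤ D) (l₁ l₂ : List M)
    (h : ∀ a ∈ l₁, ∀ b ∈ l₂, dist a b ≤ D) :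
    pathLength (l₁ ++ l₂) ≤ pathLength l₁ + D + pathLength l₂ := by
  induction l₁ with
  | nil => simp [pathLength, hD]
  | cons a l ih =>
    have ih' := ih fun x hx y hy => h x (List.mem_cons_of_mem _ hx) y hy
    cases l with
    | nil =>
      cases l₂ with
      | nil => simpa [pathLength] using hD
      | cons b l₂ => simpa [pathLength] using h a (by simp) b (by simp)
    | cons b l =>
      simp only [List.cons_append, pathLength] at ih' ⊢
      linarith

theorem pathLength_ofFn {s : ℕ} (x : Fin (s + 1) → M) :
    pathLength (List.ofFn x) = ∑ i : Fin s, dist (x i.castSucc) (x i.succ) := by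
  induction s with
  | zero => simp [pathLength]
  | succ s ih =>
    have := ih fun i => x i.succ
    rw [List.ofFn_succ] at this ⊢
    rw [List.ofFn_succ, pathLength, this, Fin.sum_univ_succ]
    rfl

theorem optLength_le {X : Finset M} {l : List M} (h : ∀ x ∈ X, x ∈ l) :
    optLength X ≤ pathLength l :=
  csInf_le ⟨0, by rintro _ ⟨l, -, rfl⟩; exact pathLength_nonneg l⟩ ⟨l, h, rfl⟩

theorem dist_le_optLength {X : Finset M} {x y : M} (hx : x ∈ X) (hy : y ∈ X) :
    dist x y ≤ optLength X := by
  refine le_csInf ⟨_, X.toList, fun z hz => Finset.mem_toList.2 hz, rfl⟩ ?_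
  rintro _ ⟨l, h, rfl⟩
  exact dist_le_pathLength l (h x hx) (h y hy)

/-- A long thin snake on `s + 1` points bounds the order ratio function at `s` from below. -/
theorem IsSnake.le_orderRatio {T : LinearOrder M} {s : ℕ} (hs : 1 ≤ s) {x : Fin (s + 1) → M}
    (hx : IsSnake T x) {w c D : ℝ} (hw : 0 ≤ w) (hc : 0 ≤ c) (hD : 0 < D)
    (hxD : dist (x ⟨0, by omega⟩) (x ⟨1, by omega⟩) = D)
    (hxw : ∀ i j : Fin (s + 1), (i : ℕ) % 2 = (j : ℕ) % 2 → dist (x i) (x j) ≤ w)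
    (hcD : c * (D + (2 * s + 4) * w) ≤ s * (D - 2 * w)) :
    ENNReal.ofReal c ≤ orderRatio T s := by
  classical
  set x0 : Fin (s + 1) := ⟨0, by omega⟩
  set x1 : Fin (s + 1) := ⟨1, by omega⟩
  have hinj : Function.Injective x :=
    StrictMono.injective (β := M) (fun i j hij => hx i j hij)
  set X : Finset M := Finset.univ.image x with hX
  have hcard : X.card = s + 1 := by
    rw [hX, Finset.card_image_of_injective _ hinj, Finset.card_univ, Fintype.card_fin]
  have hmem : ∀ i, x i ∈ X := fun i => Finset.mem_image_of_mem x (Finset.mem_univ i)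
  have hopt : 0 < optLength X := hD.trans_le (hxD ▸ dist_le_optLength (hmem x0) (hmem x1))
  have hord : s * (D - 2 * w) ≤ orderLength T X := by
    rw [orderLength, hx.sort_image, pathLength_ofFn]
    -- Consecutive indices have opposite parities, so each step joins the cluster of `x0` to that of
    -- `x1`.
    have : ∀ i : Fin s, D - 2 * w ≤ dist (x i.castSucc) (x i.succ) := by
      intro i
      rcases Nat.mod_two_eq_zero_or_one i with hi | hi
      · have h1 := hxw x0 i.castSucc (by simp [x0, hi])
        have h2 := hxw i.succ x1 (by simp [x1]; omega)
        linarith [dist_triangle4 (x x0) (x i.castSucc) (x i.succ) (x x1)]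
      · have h1 := hxw x0 i.succ (by simp [x0]; omega)
        have h2 := hxw i.castSucc x1 (by simp [x1, hi])
        have := dist_triangle4 (x x0) (x i.succ) (x i.castSucc) (x x1)
        rw [dist_comm (x i.succ)] at this
        linarith
    calc (s : ℝ) * (D - 2 * w) = ∑ _i : Fin s, (D - 2 * w) := by
          rw [Finset.sum_const, Finset.card_univ, Fintype.card_fin, nsmul_eq_mul]
      _ ≤ _ := Finset.sum_le_sum fun i _ => this i
  have hle : optLength X ≤ D + (2 * s + 4) * w := by
    -- The competing path visits all even-indexed points, then all odd-indexed ones: at most `(s +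
    -- 1) w` in each cluster plus one jump of at most `D + 2w`.
    let l : ℕ → List M := fun e =>
      ((List.finRange (s + 1)).filter fun i : Fin (s + 1) => (i : ℕ) % 2 = e).map x
    have hl : ∀ e a, a ∈ l e ↔ ∃ i : Fin (s + 1), (i : ℕ) % 2 = e ∧ x i = a := by
      intro e a; simp [l]
    have hlen : ∀ e, pathLength (l e) ≤ (s + 1) * w := by
      intro e
      refine (pathLength_le_of_dist_le hw (l e) ?_).trans ?_
      · intro a ha b hb
        obtain ⟨i, hi, rfl⟩ := (hl e a).1 ha
        obtain ⟨j, hj, rfl⟩ := (hl e b).1 hb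
        exact hxw i j (hi.trans hj.symm)
      · refine mul_le_mul_of_nonneg_right ?_ hw
        have : (l e).length ≤ s + 1 := by
          rw [List.length_map]
          exact (List.length_filter_le _ _).trans (by simp)
        exact_mod_cast this
    have hcov : ∀ a ∈ X, a ∈ l 0 ++ l 1 := by
      intro a ha
      obtain ⟨i, -, rfl⟩ := Finset.mem_image.1 ha
      rw [List.mem_append, hl, hl]
      exact (Nat.mod_two_eq_zero_or_one i).imp (fun h => ⟨i, h, rfl⟩) fun h => ⟨i, h, rfl⟩
    have happ := pathLength_append_le (D := D + 2 * w) (by positivity) (l 0) (l 1) (by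
      intro a ha b hb
      obtain ⟨i, hi, rfl⟩ := (hl _ _).1 ha
      obtain ⟨j, hj, rfl⟩ := (hl _ _).1 hb
      have h1 := hxw i x0 (by simp [x0, hi])
      have h2 := hxw x1 j (by simp [x1, hj])
      linarith [dist_triangle4 (x i) (x x0) (x x1) (x j)])
    linarith [optLength_le hcov, hlen 0, hlen 1]
  have hns : ¬ Subsingleton M := fun h => by
    rw [Subsingleton.elim (x x0) (x x1), dist_self] at hxD
    exact hD.ne hxD
  rw [orderRatio, if_neg hns]
  refine le_trans (ENNReal.ofReal_le_ofReal ?_)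
    (le_iSup₂ (f := fun (X : Finset M) (_ : 2 ≤ X.card ∧ X.card ≤ s + 1) =>
      ENNReal.ofReal (orderLength T X / optLength X)) X ⟨by omega, by omega⟩)
  rw [le_div_iff₀ hopt]
  calc c * optLength X ≤ c * (D + (2 * s + 4) * w) := mul_le_mul_of_nonneg_left hle hc
    _ ≤ orderLength T X := hcD.trans hord

theorem snakeWidth_le {k : ℕ} {x : Fin k → M} {w : ℝ} (hw : 0 ≤ w)
    (h : ∀ i j : Fin k, (i : ℕ) % 2 = (j : ℕ) % 2 → dist (x i) (x j) ≤ w) : snakeWidth x ≤ w :=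
  Real.iSup_le (fun p => h p.1.1 p.1.2 p.2) hw

theorem dist_le_snakeLength {k : ℕ} (x : Fin k → M) (i j : Fin k) :
    dist (x i) (x j) ≤ snakeLength x :=
  le_ciSup (f := fun p : Fin k × Fin k => dist (x p.1) (x p.2)) (Set.finite_range _).bddAbove (i, j)

end OrderedMetric

/-! ### Explicit width and length -/

namespace Multigraph

/-- Take `R = ⌊y⌋` and logarithms in the growth condition: `16k = 2³ · 2k`, and `3 log 2 < 4`
explains the constant `4`. -/
theorem floor_le_of_ball_growth {n d k D : ℕ} (hn : 0 < n) (hd : 3 ≤ d) (hk : 0 < k)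
    (h : ∀ R : ℕ, 16 * k * (d - 1) ^ R < n → R < D) {y : ℝ}
    (hy : y * Real.log ((d : ℝ) - 1) ≤ Real.log n - 4 - Real.log (2 * k)) :
    (⌊y⌋ : ℝ) ≤ D := by
  have hd' : (2 : ℝ) ≤ (d : ℝ) - 1 := by
    have : (3 : ℝ) ≤ d := by exact_mod_cast hd
    linarith
  have hlog : 0 < Real.log ((d : ℝ) - 1) := Real.log_pos (by linarith)
  rcases le_or_gt ⌊y⌋ 0 with h0 | h0
  · have : (⌊y⌋ : ℝ) ≤ 0 := by exact_mod_cast h0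
    exact this.trans (Nat.cast_nonneg D)
  obtain ⟨R, hR⟩ := Int.eq_ofNat_of_zero_le h0.le
  have hRy : (R : ℝ) ≤ y := by
    have := Int.floor_le y
    rw [hR] at this
    exact_mod_cast this
  have hkR : (0 : ℝ) < 2 * k := by positivity
  have hnR : (0 : ℝ) < n := by exact_mod_cast hn
  have hlt : 16 * k * (d - 1) ^ R < n := by
    have hR' : (16 * k * ((d : ℝ) - 1) ^ R) < n := by
      rw [← Real.log_lt_log_iff (by positivity) hnR,
        show (16 : ℝ) * k * ((d : ℝ) - 1) ^ R = 2 ^ 3 * ((2 * k) * ((d : ℝ) - 1) ^ R) by ring,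
        Real.log_mul (by norm_num) (by positivity), Real.log_mul hkR.ne' (by positivity),
        Real.log_pow, Real.log_pow]
      have := mul_le_mul_of_nonneg_right hRy hlog.le
      have := Real.log_two_lt_d9
      push_cast
      linarith
    have hcast : ((d - 1 : ℕ) : ℝ) = (d : ℝ) - 1 := by
      rw [Nat.cast_sub (by omega), Nat.cast_one]
    rw [← hcast] at hR'
    exact_mod_cast hR'
  rw [hR]
  exact_mod_cast (h R hlt).le

variable {V : Type u} [Fintype V] [Nontrivial V] {G : Multigraph V} {d : ℕ}

/-- The rounding error of the ceiling is absorbed by `1 ≤ 2/δ`. -/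
theorem radius_lt {k : ℕ} (hk : 2 ≤ k) {δ : ℝ} (hδ : 0 < δ) (hδ2 : δ ≤ 2) :
    2 * ((⌈3 * Real.log (2 * k) / δ⌉₊ : ℕ) : ℝ) ≤ (6 * Real.log (2 * k) + 4) / δ := by
  have hk' : (2 : ℝ) ≤ k := by exact_mod_cast hk
  have hlog : 0 ≤ Real.log (2 * k) := Real.log_nonneg (by linarith)
  have h1 := (Nat.ceil_lt_add_one (by positivity : 0 ≤ 3 * Real.log (2 * k) / δ)).le
  have h2 : (1 : ℝ) ≤ 2 / δ := by rwa [le_div_iff₀ hδ, one_mul]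
  calc 2 * ((⌈3 * Real.log (2 * k) / δ⌉₊ : ℕ) : ℝ) ≤ 2 * (3 * Real.log (2 * k) / δ + 2 / δ) := by
        linarith
    _ = _ := by ring

/-- Snakes of explicit width and length in a connected regular graph. -/
theorem IsRegular.admitsSnake (hd : G.IsRegular d) (hG : G.Connected) (hd3 : 3 ≤ d)
    (T : LinearOrder V) {k : ℕ} (hk : 2 ≤ k) (hkn : k ≤ Fintype.card V) :
    @AdmitsSnake V (metricSpace hG) T k
      (⌈24 * k * (Real.log k + Real.log (2 / G.spectralGap d)) / G.spectralGap d⌉ : ℤ)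
      ((⌊(Real.log (Fintype.card V) - 4 - 2 * k * Real.log (2 * k)
          - 2 * k * Real.log (2 / G.spectralGap d)) / Real.log ((d : ℝ) - 1)⌋ - 1 : ℤ) : ℝ) := by
  let _ := metricSpace hG
  have hδ := hd.spectralGap_pos hG (by omega)
  have hδ2 := hd.spectralGap_le_two hG (by omega)
  set δ := G.spectralGap d
  obtain ⟨x, hx, hxw, hxR⟩ := hd.exists_isSnake hG hd3 T hk hkn
    (exp_ceil_radius (by omega : 0 < k) hδ)
  have hk' : (2 : ℝ) ≤ k := by exact_mod_cast hk
  have hk0 : (k : ℝ) ≠ 0 := by positivity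
  have hlogδ : 0 ≤ Real.log (2 / δ) := Real.log_nonneg (by rwa [le_div_iff₀ hδ, one_mul])
  have hlog2 := Real.log_two_gt_d9
  have hlogk : Real.log 2 ≤ Real.log k := Real.log_le_log (by norm_num) hk'
  have hlog2k : Real.log (2 * k) = Real.log 2 + Real.log k := Real.log_mul (by norm_num) hk0
  refine ⟨x, hx, snakeWidth_le (w := _) ?_ ?_, ?_⟩
  · have : (0 : ℝ) ≤ 24 * k * (Real.log k + Real.log (2 / δ)) / δ := by
      have : 0 ≤ Real.log k + Real.log (2 / δ) := by linarith
      positivity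
    exact this.trans (Int.le_ceil _)
  · intro i j hij
    calc dist (x i) (x j) ≤ 2 * ((⌈3 * Real.log (2 * k) / δ⌉₊ : ℕ) : ℝ) := by
          change (G.support.dist (x i) (x j) : ℝ) ≤ _
          exact_mod_cast hxw i j hij
      _ ≤ (6 * Real.log (2 * k) + 4) / δ := radius_lt hk hδ hδ2
      _ ≤ 24 * k * (Real.log k + Real.log (2 / δ)) / δ := by
          gcongr
          nlinarith [mul_nonneg (by linarith : (0 : ℝ) ≤ k - 2)
            (by linarith : 0 ≤ Real.log k + Real.log (2 / δ))]
      _ ≤ _ := Int.le_ceil _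
  · refine le_trans ?_ (dist_le_snakeLength x ⟨0, by omega⟩ ⟨1, by omega⟩)
    have hlogd : 0 < Real.log ((d : ℝ) - 1) := Real.log_pos (by
      have : (3 : ℝ) ≤ d := by exact_mod_cast hd3
      linarith)
    have := floor_le_of_ball_growth Fintype.card_pos hd3 (by omega) hxR (y := _)
      (le_trans (div_mul_cancel₀ (Real.log (Fintype.card V) - 4 - 2 * k * Real.log (2 * k)
          - 2 * k * Real.log (2 / δ)) hlogd.ne').le (by
        have : 0 ≤ 2 * k * Real.log (2 / δ) := by positivity
        nlinarith [mul_nonneg (by linarith : (0 : ℝ) ≤ 2 * k - 1)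
          (by linarith : 0 ≤ Real.log (2 * k))]))
    push_cast
    exact (sub_le_self _ zero_le_one).trans this

end Multigraph

/-! ### Infinite breakpoint and the three statements -/

theorem seqOrderBreakpoint_eq_top {M : ℕ → Type u} {m : ∀ i, MetricSpace (M i)}
    {T : ∀ i, LinearOrder (M i)}
    (h : ∀ s : ℕ, 1 ≤ s → ∀ c : ℝ, 0 ≤ c → c < s →
      ∃ i, ENNReal.ofReal c ≤ @orderRatio (M i) (m i) (T i) s) :
    seqOrderBreakpoint m T = ⊤ := by
  simp only [seqOrderBreakpoint, iInf_eq_top]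
  rintro s ⟨hs, hlt⟩
  exfalso
  refine hlt.not_ge (le_of_forall_lt_imp_le_of_dense fun a ha => ?_)
  have ha' : a ≠ ⊤ := (ha.trans_le le_top).ne
  obtain ⟨i, hi⟩ := h s hs a.toReal ENNReal.toReal_nonneg (by
    have := (ENNReal.toReal_lt_toReal ha' (ENNReal.natCast_ne_top s)).2 ha
    rwa [ENNReal.toReal_natCast] at this)
  rw [ENNReal.ofReal_toReal ha'] at hi
  exact hi.trans (le_iSup (fun i => @orderRatio (M i) (m i) (T i) s) i)

/-- Regular graphs whose inverse spectral gaps are small compared with the logarithms of the numbers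
of vertices have infinite order breakpoint. -/
theorem seqOrderBreakpoint_multigraph_eq_top {V : ℕ → Type u} [∀ i, Fintype (V i)]
    [∀ i, Nontrivial (V i)] {G : ∀ i, Multigraph (V i)} {d : ℕ → ℕ} (hG : ∀ i, (G i).Connected)
    (T : ∀ i, LinearOrder (V i)) (hd3 : ∀ i, 3 ≤ d i) (hd : ∀ i, (G i).IsRegular (d i))
    (hn : Tendsto (fun i => Real.logb (d i) (Fintype.card (V i))) atTop atTop)
    (ho : (fun i => 1 / (G i).spectralGap (d i)) =o[atTop]
      (fun i => Real.logb (d i) (Fintype.card (V i)))) :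
    seqOrderBreakpoint (fun i => Multigraph.metricSpace (hG i)) T = ⊤ := by
  refine seqOrderBreakpoint_eq_top fun s hs c hc hcs => ?_
  have hsR : (1 : ℝ) ≤ s := by exact_mod_cast hs
  -- The constants are chosen so that the width is at most `K/δ`, the distance `D` of the first two
  -- points is at least `ℓ - C`, and `w ≤ ε D` implies the inequality required by
  -- `IsSnake.le_orderRatio`.
  set K : ℝ := 6 * Real.log (2 * (s + 1 : ℕ)) + 4
  have hlogs : 0 ≤ Real.log (2 * (s + 1 : ℕ)) := Real.log_nonneg (by push_cast; linarith)
  have hK : 0 < K := by positivity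
  set C : ℝ := (4 + Real.log (2 * (s + 1 : ℕ))) / Real.log 2 + 1
  have hlog2 : 0 < Real.log 2 := Real.log_pos (by norm_num)
  have hC : 0 < C := by positivity
  set ε : ℝ := (s - c) / (2 * s + c * (2 * s + 4))
  have hε : 0 < ε := div_pos (by linarith) (by positivity)
  -- The three conditions give `w ≤ ε ℓ/2`, `ℓ - C ≥ ℓ/2`, and at least `s + 1` vertices (as `ℓ ≤
  -- log n`, because `d ≥ 3 > e`).
  have hev := ((ho.bound (by positivity : 0 < ε / (2 * K))).and (hn.eventually_ge_atTop (2 * C))).and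
    (hn.eventually_ge_atTop (Real.log (s + 1 : ℕ)))
  obtain ⟨i, ⟨hio, hiC⟩, hin⟩ := hev.exists
  refine ⟨i, ?_⟩
  set ℓ := Real.logb (d i) (Fintype.card (V i)) with hℓ
  have hd3R : (3 : ℝ) ≤ d i := by exact_mod_cast hd3 i
  have hnR : (1 : ℝ) ≤ Fintype.card (V i) := by exact_mod_cast Fintype.card_pos
  have hlogn : 0 ≤ Real.log (Fintype.card (V i)) := Real.log_nonneg hnR
  have hlogd : 1 ≤ Real.log (d i) := by
    rw [Real.le_log_iff_exp_le (by linarith)]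
    linarith [Real.exp_one_lt_d9]
  have hlogd1 : Real.log 2 ≤ Real.log ((d i : ℝ) - 1) :=
    Real.log_le_log (by norm_num) (by linarith)
  have hlogd2 : Real.log ((d i : ℝ) - 1) ≤ Real.log (d i) :=
    Real.log_le_log (by linarith) (by linarith)
  have hkn : s + 1 ≤ Fintype.card (V i) := by
    have h1 : Real.log (s + 1 : ℕ) ≤ Real.log (Fintype.card (V i)) :=
      hin.trans (div_le_self hlogn hlogd)
    have h2 := (Real.log_le_log_iff (by positivity) (by linarith)).1 h1
    exact_mod_cast h2
  have hδ := (hd i).spectralGap_pos (hG i) (by linarith [hd3 i])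
  have hδ2 := (hd i).spectralGap_le_two (hG i) (by linarith [hd3 i])
  set δ := (G i).spectralGap (d i)
  let _ := Multigraph.metricSpace (hG i)
  obtain ⟨x, hx, hxw, hxR⟩ := (hd i).exists_isSnake (hG i) (hd3 i) (T i) (k := s + 1) (by omega) hkn
    (Multigraph.exp_ceil_radius (by omega : 0 < s + 1) hδ)
  have hwK := Multigraph.radius_lt (k := s + 1) (by omega) hδ hδ2
  set w : ℝ := 2 * ((⌈3 * Real.log (2 * (s + 1 : ℕ)) / δ⌉₊ : ℕ) : ℝ) with hw
  have hw0 : 0 ≤ w := by positivity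
  have hℓ0 : 0 < ℓ := by linarith
  have hwℓ : w ≤ ε * (ℓ / 2) := by
    rw [Real.norm_of_nonneg (by positivity), Real.norm_of_nonneg hℓ0.le] at hio
    calc w ≤ K * (1 / δ) := hwK.trans_eq (by ring)
      _ ≤ K * (ε / (2 * K) * ℓ) := by gcongr
      _ = ε * (ℓ / 2) := by field_simp
  have hD : ℓ / 2 ≤ dist (x ⟨0, by omega⟩) (x ⟨1, by omega⟩) := by
    set a := 4 + Real.log (2 * (s + 1 : ℕ)) with ha
    have hfl := Multigraph.floor_le_of_ball_growth Fintype.card_pos (hd3 i) (by omega) hxR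
      (y := (Real.log (Fintype.card (V i)) - a) / Real.log ((d i : ℝ) - 1))
      (by rw [div_mul_cancel₀ _ (by linarith)]; linarith)
    have h1 : ℓ ≤ Real.log (Fintype.card (V i)) / Real.log ((d i : ℝ) - 1) :=
      div_le_div_of_nonneg_left hlogn (by linarith) hlogd2
    have h2 : a / Real.log ((d i : ℝ) - 1) ≤ a / Real.log 2 :=
      div_le_div_of_nonneg_left (by positivity) hlog2 hlogd1
    have h3 := Int.lt_floor_add_one
      ((Real.log (Fintype.card (V i)) - a) / Real.log ((d i : ℝ) - 1))
    rw [sub_div] at h3 hfl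
    have h4 : ℓ - C ≤ ((G i).support.dist (x ⟨0, by omega⟩) (x ⟨1, by omega⟩) : ℝ) := by
      simp only [C]
      linarith
    change ℓ / 2 ≤ ((G i).support.dist (x ⟨0, by omega⟩) (x ⟨1, by omega⟩) : ℝ)
    linarith
  refine hx.le_orderRatio hs (w := w) hw0 hc (lt_of_lt_of_le (by positivity) hD) rfl
    (fun a b hab => by
      change ((G i).support.dist (x a) (x b) : ℝ) ≤ _
      rw [hw]
      exact_mod_cast hxw a b hab) ?_
  set D := dist (x ⟨0, by omega⟩) (x ⟨1, by omega⟩)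
  have hwD : w ≤ ε * D := hwℓ.trans (mul_le_mul_of_nonneg_left hD hε.le)
  have h1 : (2 * s + c * (2 * s + 4)) * w ≤ (s - c) * D := by
    calc (2 * s + c * (2 * s + 4)) * w ≤ (2 * s + c * (2 * s + 4)) * (ε * D) := by gcongr
      _ = (s - c) * D := by
        have : 2 * s + c * (2 * s + 4) ≠ 0 := by positivity
        simp only [ε]
        field_simp
  linarith

/-- Dividing by `log v` only shrinks the comparison function once `log v ≥ 1`. -/
theorem isLittleO_of_isLittleO_div_log {u v : ℕ → ℝ} (hv : Tendsto v atTop atTop)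
    (h : u =o[atTop] fun i => v i / Real.log (v i)) : u =o[atTop] v := by
  refine h.trans_isBigO (IsBigO.of_bound 1 ?_)
  filter_upwards [(Real.tendsto_log_atTop.comp hv).eventually_ge_atTop 1] with i hi
  rw [norm_div, one_mul]
  exact div_le_self (norm_nonneg _) (hi.trans (le_abs_self _))

theorem mainTheorem3 :
    -- (1) a spectral condition for infinite order breakpoint
    (∀ (V : ℕ → Type u) [∀ i, Fintype (V i)] [∀ i, Nontrivial (V i)]
        (G : ∀ i, Multigraph (V i)) (d : ℕ → ℕ) (hG : ∀ i, (G i).Connected)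
        (T : ∀ i, LinearOrder (V i)),
      (∀ i, 3 ≤ d i) → (∀ i, (G i).IsRegular (d i)) →
      Tendsto (fun i => Real.logb (d i) (Fintype.card (V i))) atTop atTop →
      (fun i => 1 / (G i).spectralGap (d i)) =o[atTop]
        (fun i => Real.logb (d i) (Fintype.card (V i)) /
          Real.log (Real.logb (d i) (Fintype.card (V i)))) →
      seqOrderBreakpoint (fun i => Multigraph.metricSpace (hG i)) T = ⊤) ∧
    -- (2) explicit width and length of snakes
    (∀ (V : Type u) [Fintype V] [Nontrivial V] (G : Multigraph V) (d : ℕ) (hG : G.Connected)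
        (T : LinearOrder V) (k : ℕ),
      3 ≤ d → G.IsRegular d → 2 ≤ k → k ≤ Fintype.card V →
      @AdmitsSnake V (Multigraph.metricSpace hG) T k
        (⌈24 * k * (Real.log k + Real.log (2 / G.spectralGap d)) / G.spectralGap d⌉ : ℤ)
        ((⌊(Real.log (Fintype.card V) - 4 - 2 * k * Real.log (2 * k)
            - 2 * k * Real.log (2 / G.spectralGap d)) / Real.log ((d : ℝ) - 1)⌋ - 1 : ℤ) : ℝ)) ∧
    -- (3) bounded degree expanders; the constants depend only on `k` and `δ`
    (∀ (k : ℕ) (δ : ℝ), 2 ≤ k → 0 < δ → ∃ C C' : ℝ, 0 < C ∧ 0 < C' ∧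
      ∀ (V : ℕ → Type u) [∀ i, Fintype (V i)] [∀ i, Nontrivial (V i)]
        (G : ∀ i, Multigraph (V i)) (d : ℕ) (hG : ∀ i, (G i).Connected)
        (T : ∀ i, LinearOrder (V i)),
      3 ≤ d → (∀ i, (G i).IsRegular d) → δ = ⨅ i, (G i).spectralGap d →
      ∀ i, k ≤ Fintype.card (V i) →
        @AdmitsSnake (V i) (Multigraph.metricSpace (hG i)) (T i) k C
          (Real.logb ((d : ℝ) - 1) (Fintype.card (V i)) - C')) := by
  refine ⟨?_, ?_, ?_⟩
  · intro V _ _ G d hG T hd3 hd hn ho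
    exact seqOrderBreakpoint_multigraph_eq_top hG T hd3 hd hn (isLittleO_of_isLittleO_div_log hn ho)
  · intro V _ _ G d hG T k hd3 hd hk hkn
    exact hd.admitsSnake hG hd3 T hk hkn
  · intro k δ hk hδ
    have hk' : (2 : ℝ) ≤ k := by exact_mod_cast hk
    have hlogk : 0 ≤ Real.log k := Real.log_nonneg (by linarith)
    have hlog2k : 0 ≤ Real.log (2 * k) := Real.log_nonneg (by linarith)
    have hlog2 : 0 < Real.log 2 := Real.log_pos (by norm_num)
    -- `W` and `a` are the expressions of part (2) at the infimum `δ`; both dominate those at each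
    -- gap by monotonicity. The absolute values keep the constants positive even for `δ > 2`, which
    -- no graph realises. The extra `1` pays for the ceiling, the extra `2` for the floor and the
    -- final `-1`.
    set W : ℝ := 24 * k * (Real.log k + Real.log (2 / δ)) / δ
    set a : ℝ := 4 + 2 * k * Real.log (2 * k) + 2 * k * Real.log (2 / δ)
    refine ⟨|W| + 1, |a| / Real.log 2 + 2, by positivity, by positivity, ?_⟩
    intro V _ _ G d hG T hd3 hd hinf i hkn
    have hδi : 0 < (G i).spectralGap d := (hd i).spectralGap_pos (hG i) (by omega)
    have hle : δ ≤ (G i).spectralGap d := by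
      rw [hinf]
      refine ciInf_le ⟨0, ?_⟩ i
      rintro _ ⟨j, rfl⟩
      exact ((hd j).spectralGap_pos (hG j) (by omega)).le
    have hle2 : (G i).spectralGap d ≤ 2 := (hd i).spectralGap_le_two (hG i) (by omega)
    obtain ⟨x, hx, hxw, hxl⟩ := (hd i).admitsSnake (hG i) hd3 (T i) hk hkn
    set δi := (G i).spectralGap d
    have hlogi : Real.log (2 / δi) ≤ Real.log (2 / δ) :=
      Real.log_le_log (by positivity) (by gcongr)
    have hlogi0 : 0 ≤ Real.log (2 / δi) := Real.log_nonneg (by rwa [le_div_iff₀ hδi, one_mul])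
    refine ⟨x, hx, hxw.trans ?_, le_trans ?_ hxl⟩
    · refine (Int.ceil_lt_add_one _).le.trans ?_
      gcongr
      refine le_trans ?_ (le_abs_self W)
      have : 0 ≤ Real.log k + Real.log (2 / δ) := by linarith
      simp only [W]
      gcongr
    · have hd3R : (3 : ℝ) ≤ d := by exact_mod_cast hd3
      have hlogd : Real.log 2 ≤ Real.log ((d : ℝ) - 1) :=
        Real.log_le_log (by norm_num) (by linarith)
      have h1 : |a| / Real.log ((d : ℝ) - 1) ≤ |a| / Real.log 2 :=
        div_le_div_of_nonneg_left (abs_nonneg a) hlog2 hlogd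
      have h2 : 4 + 2 * k * Real.log (2 * k) + 2 * k * Real.log (2 / δi) ≤ |a| := by
        refine le_trans ?_ (le_abs_self a)
        simp only [a]
        gcongr
      have h3 : (Real.log (Fintype.card (V i)) - |a|) / Real.log ((d : ℝ) - 1) ≤
          (Real.log (Fintype.card (V i)) - 4 - 2 * k * Real.log (2 * k)
            - 2 * k * Real.log (2 / δi)) / Real.log ((d : ℝ) - 1) :=
        div_le_div_of_nonneg_right (by linarith) (by linarith)
      have h4 := Int.lt_floor_add_one ((Real.log (Fintype.card (V i)) - 4
        - 2 * k * Real.log (2 * k) - 2 * k * Real.log (2 / δi)) / Real.log ((d : ℝ) - 1))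
      rw [sub_div] at h3
      rw [Real.logb]
      push_cast
      linarith
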